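/- For $d,N\in\mathbb N=\{1,2,\dots\}$ let $B_N=\{x\in\mathbb R^d: x_1^2+\dots+x_d^2\le N^2\}$ be the closed Euclidean ball of radius $N$, put $\kappa(d,N)=Nd^{-1/2}$, and for $\xi$ in the torus $\mathbb T^d=(\mathbb R/\mathbb Z)^d$ let $$\mathfrak m_N(\xi)=\frac1{|B_N\cap\mathbb Z^d|}\sum_{x\in B_N\cap\mathbb Z^d}e^{2\pi i\,\xi\cdot x},\qquad \|\xi\|=\Big(\sum_{j=1}^d\|\xi_j\|^2\Big)^{1/2},\quad \|\xi_j\|=\operatorname{dist}(\xi_j,\mathbb Z).$$ **Proposition.** There is an absolute constant $C>0$ (in particular independent of $d$, $N$ and $\xi$) such that for all $d,N\in\mathbb N$ with $10\le\kappa(d,N)\le 50\,d^{1/2}$ and all $\xi\in\mathbb T^d\setminus\{0\}$, $$|\mathfrak m_N(\xi)|\le C\Big((\kappa(d,N)\|\xi\|)^{-1}+\kappa(d,N)^{-1/7}\Big).$$ -/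

import Mathlib

/-- The lattice points `B_t ∩ ℤ^d` of the closed Euclidean ball of radius `t` centred at the origin
of `ℝ^d`. -/
def latticeBall (d : ℕ) (t : ℝ) : Set (Fin d → ℤ) :=
  {x | WithLp.toLp 2 (fun i => (x i : ℝ)) ∈ Metric.closedBall (0 : EuclideanSpace ℝ (Fin d)) t}

theorem latticeBall_finite (d : ℕ) (t : ℝ) : (latticeBall d t).Finite := by
  refine (Set.Finite.pi' (fun _ : Fin d => Set.finite_Icc (-⌈t⌉) ⌈t⌉)).subset ?_
  intro x hx i
  have h1 : ‖WithLp.toLp 2 (fun i => (x i : ℝ))‖ ≤ t := by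
    simpa [latticeBall] using hx
  have h2 : |(x i : ℝ)| ≤ t := by
    have := (PiLp.norm_apply_le (WithLp.toLp 2 (fun i => (x i : ℝ))) i).trans h1
    simpa using this
  have h3 : |(x i : ℝ)| ≤ (⌈t⌉ : ℝ) := h2.trans (Int.le_ceil t)
  have h4 : |x i| ≤ ⌈t⌉ := by exact_mod_cast h3
  exact Set.mem_Icc.2 (abs_le.1 h4)

/-- The multiplier `𝔪_t(ξ) = |B_t ∩ ℤ^d|⁻¹ ∑_{x ∈ B_t ∩ ℤ^d} e^{2πi ξ·x}` on the torus
`(ℝ/ℤ)^d`; the character `e^{2πi ξ·x}` is `UnitAddTorus.mFourier x ξ`. -/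
noncomputable def ballMultiplier (d : ℕ) (t : ℝ) (ξ : UnitAddTorus (Fin d)) : ℂ :=
  ((latticeBall_finite d t).toFinset.card : ℂ)⁻¹ *
    ∑ x ∈ (latticeBall_finite d t).toFinset, UnitAddTorus.mFourier x ξ

/-- The proportionality constant `κ(d, t) = t d^{-1/2}`. -/
noncomputable def ballKappa (d : ℕ) (t : ℝ) : ℝ :=
  t * (d : ℝ) ^ (-(1 / 2) : ℝ)

/-- `‖ξ‖ = (‖ξ_1‖² + ... + ‖ξ_d‖²)^{1/2}`, where `‖ξ_j‖` is the distance of `ξ_j` to `ℤ`: this is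
the quotient norm on `ℝ/ℤ`. (The norm `‖ξ‖` in Mathlib on the product is the maximum instead.) -/
noncomputable def torusNorm {d : ℕ} (ξ : UnitAddTorus (Fin d)) : ℝ :=
  Real.sqrt (∑ i, ‖ξ i‖ ^ 2)

/-!
The bound holds in the stronger form `|𝔪_N(ξ)| ≤ C ((κ ‖ξ‖)⁻¹ + κ⁻¹)`. It is trivial for bounded
`κ`, so let `κ` be large, let `r i` be representatives of `ξ i` with `|r i| = ‖ξ i‖`, let `j` be the
index of the largest `|r i|`, and let `ρ` be a small multiple of `κ`.

The ball is invariant under sign changes, so exponentials may be replaced by cosines. Summing first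
over the slices in direction `j`, which are symmetric intervals, gives the Dirichlet kernel bound
`1 / (2 |r j|)`; the other coordinates are estimated by the weight `∏ i ∈ S, |cos (2π x_i r_i)|`,
where `S` does not contain `j` (`norm_sum_prod_exp_le_restrict`). Two facts are then needed.

* The average of the weight over the ball is at most `exp (-c ∑ i ∈ S, min 1 ((ρ r_i) ^ 2))`
  (`sum_cosWeight_le`). The coordinates are treated one at a time: on a slice of length at least
  `ρ` the average of `|cos (2π n r_i)|` is at most `1 - c min 1 ((ρ r_i) ^ 2)`, and since the ball is
  invariant under permutations, the slice is that long for a fixed proportion of the weight left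
  (`sum_cosWeight_insert_le`).
* The Dirichlet kernel really gains a factor `O(1 / (ρ |r j|))` on average, that is, slices much
  shorter than `ρ` are rare (`sum_cosWeight_restrict_le`).

Both hold up to the contribution of the points of which more than a quarter of the coordinates are
smaller than `ρ`. An exponential moment bound (`two_pow_mul_card_fewLarge_le`) shows that their
proportion is at most `2 ^ (-d)`, and this is `O(κ⁻¹)` because `κ ≤ 50 √d`.

If `|r j| ≥ 1 / 4`, the second fact with `S = ∅` suffices. Otherwise `S` is taken to be half of the
coordinates other than `j`, carrying at least half of
`A = ∑ i ≠ j, min 1 ((ρ r_i) ^ 2)`. Since `ρ ‖ξ‖ ≤ max 1 (ρ |r j|) √(1 + A)`, the product of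
`min 1 (1 / (ρ |r j|))` and `exp (-c A)` is `O(1 / (κ ‖ξ‖))`.
-/

open Finset

/-! ### Slices of the lattice ball -/

/-- The integer points `x` with `∑ i, x i ^ 2 ≤ N ^ 2`, as a finset. -/
noncomputable def intBall (ι : Type*) [Fintype ι] [DecidableEq ι] (N : ℕ) : Finset (ι → ℤ) :=
  {x ∈ Fintype.piFinset fun _ => Icc (-(N : ℤ)) N | ∑ i, x i ^ 2 ≤ (N : ℤ) ^ 2}

section Slicing

variable {ι : Type*} [Fintype ι] [DecidableEq ι] {N : ℕ}

theorem mem_intBall {x : ι → ℤ} : x ∈ intBall ι N ↔ ∑ i, x i ^ 2 ≤ (N : ℤ) ^ 2 := by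
  simp only [intBall, mem_filter, Fintype.mem_piFinset, mem_Icc, and_iff_right_iff_imp]
  intro h i
  have h1 : x i ^ 2 ≤ (N : ℤ) ^ 2 :=
    (single_le_sum (f := fun i => x i ^ 2) (fun i _ => sq_nonneg (x i)) (mem_univ i)).trans h
  exact abs_le.1 (abs_le_of_sq_le_sq h1 (by positivity))

theorem latticeBall_toFinset_eq (d N : ℕ) :
    (latticeBall_finite d N).toFinset = intBall (Fin d) N := by
  ext x
  rw [Set.Finite.mem_toFinset, mem_intBall]
  simp only [latticeBall, Set.mem_ofPred_eq, mem_closedBall_zero_iff, EuclideanSpace.norm_eq,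
    Real.norm_eq_abs, sq_abs]
  rw [Real.sqrt_le_left (by positivity)]
  exact_mod_cast Iff.rfl

/-- The largest value that the square of the `j`-th coordinate can take on the ball, once the other
coordinates are those of `x`. -/
noncomputable def room (N : ℕ) (j : ι) (x : ι → ℤ) : ℤ := (N : ℤ) ^ 2 - ∑ i ∈ univ.erase j, x i ^ 2

/-- The slice of the ball through `x` in direction `j` consists of the points whose `j`-th
coordinate `n` satisfies `|n| ≤ sliceRadius N j x`. -/
noncomputable def sliceRadius (N : ℕ) (j : ι) (x : ι → ℤ) : ℕ := (room N j x).toNat.sqrt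

theorem room_update (j : ι) (x : ι → ℤ) (n : ℤ) :
    room N j (Function.update x j n) = room N j x := by
  unfold room
  congr 1
  exact sum_congr rfl fun i hi => by rw [Function.update_of_ne (ne_of_mem_erase hi)]

theorem room_sub_sq (j : ι) (x : ι → ℤ) :
    room N j x - x j ^ 2 = (N : ℤ) ^ 2 - ∑ i, x i ^ 2 := by
  rw [room, ← add_sum_erase univ (fun i => x i ^ 2) (mem_univ j)]
  ring

theorem mem_intBall_iff_room (j : ι) {x : ι → ℤ} : x ∈ intBall ι N ↔ x j ^ 2 ≤ room N j x := by
  rw [mem_intBall]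
  have := room_sub_sq (N := N) j x
  constructor <;> intro h <;> linarith

theorem sliceRadius_update (j : ι) (x : ι → ℤ) (n : ℤ) :
    sliceRadius N j (Function.update x j n) = sliceRadius N j x := by
  rw [sliceRadius, room_update, sliceRadius]

theorem sq_le_room_iff {j : ι} {x : ι → ℤ} (hx : 0 ≤ room N j x) (n : ℤ) :
    n ^ 2 ≤ room N j x ↔ n ∈ Icc (-(sliceRadius N j x : ℤ)) (sliceRadius N j x) := by
  rw [mem_Icc, ← abs_le, sliceRadius, ← Int.natCast_natAbs, Nat.cast_le, Nat.le_sqrt',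
    ← Int.natAbs_sq]
  zify
  rw [Int.toNat_of_nonneg hx]

theorem room_nonneg {j : ι} {x : ι → ℤ} (hx : x ∈ intBall ι N) : 0 ≤ room N j x :=
  (sq_nonneg _).trans ((mem_intBall_iff_room j).1 hx)

/-- Summation over the ball by slices in direction `j`. -/
theorem sum_intBall_slice {E : Type*} [AddCommMonoid E] (j : ι) (f : (ι → ℤ) → E) :
    ∑ x ∈ intBall ι N, f x = ∑ y ∈ intBall ι N with y j = 0,
      ∑ n ∈ Icc (-(sliceRadius N j y : ℤ)) (sliceRadius N j y), f (Function.update y j n) := by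
  rw [sum_sigma']
  refine sum_nbij' (fun x => ⟨Function.update x j 0, x j⟩) (fun p => Function.update p.1 j p.2)
    ?_ ?_ ?_ ?_ ?_
  · intro x hx
    have h0 := room_nonneg (j := j) hx
    simp only [mem_sigma, mem_filter, Function.update_self, and_true]
    rw [mem_intBall_iff_room j, room_update, Function.update_self, sliceRadius_update,
      ← sq_le_room_iff h0]
    exact ⟨by simpa using h0, (mem_intBall_iff_room j).1 hx⟩
  · rintro ⟨y, n⟩ h
    simp only [mem_sigma, mem_filter] at h
    rw [mem_intBall_iff_room j, room_update, Function.update_self]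
    exact (sq_le_room_iff (room_nonneg h.1.1) n).2 h.2
  · intro x _
    simp
  · rintro ⟨y, n⟩ h
    simp only [mem_sigma, mem_filter] at h
    have : Function.update y j 0 = y := by rw [← h.1.2, Function.update_eq_self]
    simp [this]
  · intro x _
    simp

theorem sum_intBall_le_of_slice (j : ι) {f g : (ι → ℤ) → ℝ}
    (h : ∀ y ∈ intBall ι N,
      ∑ n ∈ Icc (-(sliceRadius N j y : ℤ)) (sliceRadius N j y), f (Function.update y j n) ≤
      ∑ n ∈ Icc (-(sliceRadius N j y : ℤ)) (sliceRadius N j y), g (Function.update y j n)) :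
    ∑ x ∈ intBall ι N, f x ≤ ∑ x ∈ intBall ι N, g x := by
  rw [sum_intBall_slice j f, sum_intBall_slice j g]
  exact sum_le_sum fun y hy => h y (mem_filter.1 hy).1

theorem norm_sum_intBall_le_of_slice {E : Type*} [SeminormedAddCommGroup E] (j : ι)
    {f : (ι → ℤ) → E} {g : (ι → ℤ) → ℝ}
    (h : ∀ y ∈ intBall ι N,
      ‖∑ n ∈ Icc (-(sliceRadius N j y : ℤ)) (sliceRadius N j y), f (Function.update y j n)‖ ≤
      ∑ n ∈ Icc (-(sliceRadius N j y : ℤ)) (sliceRadius N j y), g (Function.update y j n)) :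
    ‖∑ x ∈ intBall ι N, f x‖ ≤ ∑ x ∈ intBall ι N, g x := by
  rw [sum_intBall_slice j f, sum_intBall_slice j g]
  exact norm_sum_le_of_le _ fun y hy => h y (mem_filter.1 hy).1

theorem sum_intBall_comp_swap {E : Type*} [AddCommMonoid E] (i j : ι) (f : (ι → ℤ) → E) :
    ∑ x ∈ intBall ι N, f (x ∘ Equiv.swap i j) = ∑ x ∈ intBall ι N, f x := by
  have hmem : ∀ x ∈ intBall ι N, x ∘ Equiv.swap i j ∈ intBall ι N := fun x hx => by
    rw [mem_intBall] at hx ⊢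
    simpa using (Equiv.sum_comp (Equiv.swap i j) fun k => x k ^ 2).trans_le hx
  refine sum_nbij' (fun x => x ∘ Equiv.swap i j) (fun x => x ∘ Equiv.swap i j) hmem hmem ?_ ?_ ?_
  all_goals
    intro x _
    try ext k
    simp

end Slicing

/-! ### Sums of cosines over symmetric intervals -/

section Dirichlet

theorem sum_Icc_neg_succ {E : Type*} [AddCommGroup E] (f : ℤ → E) (M : ℕ) :
    ∑ n ∈ Icc (-((M + 1 : ℕ) : ℤ)) ((M + 1 : ℕ) : ℤ), f n =
      ∑ n ∈ Icc (-(M : ℤ)) M, f n + (f (M + 1) + f (-(M + 1))) := by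
  have h : Icc (-((M + 1 : ℕ) : ℤ)) ((M + 1 : ℕ) : ℤ) =
      insert (-((M : ℤ) + 1)) (insert ((M : ℤ) + 1) (Icc (-(M : ℤ)) M)) := by
    ext n
    simp only [mem_Icc, mem_insert]
    push_cast
    omega
  rw [h, sum_insert, sum_insert]
  · abel
  · simp
  · simp only [mem_insert, mem_Icc]
    omega

theorem card_Icc_neg (M : ℕ) : ((#(Icc (-(M : ℤ)) M) : ℕ) : ℝ) = 2 * M + 1 := by
  rw [Int.card_Icc]
  have : ((M : ℤ) + 1 - -(M : ℤ)).toNat = 2 * M + 1 := by omega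
  rw [this]
  push_cast
  ring

theorem sin_mul_sum_cos (r : ℝ) (M : ℕ) :
    Real.sin (Real.pi * r) * ∑ n ∈ Icc (-(M : ℤ)) M, Real.cos (2 * Real.pi * n * r) =
      Real.sin ((2 * M + 1) * (Real.pi * r)) := by
  induction M with
  | zero => simp
  | succ M ih =>
    rw [sum_Icc_neg_succ, mul_add, ih]
    push_cast
    have e1 : 2 * Real.pi * (-((M : ℝ) + 1)) * r = -(2 * Real.pi * ((M : ℝ) + 1) * r) := by ring
    have e2 : (2 * (M : ℝ) + 1) * (Real.pi * r) =
      2 * Real.pi * ((M : ℝ) + 1) * r - Real.pi * r := by ring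
    have e3 : (2 * ((M : ℝ) + 1) + 1) * (Real.pi * r) =
      2 * Real.pi * ((M : ℝ) + 1) * r + Real.pi * r := by ring
    rw [e1, Real.cos_neg, e2, e3, Real.sin_sub, Real.sin_add]
    ring

theorem two_mul_abs_le_abs_sin_pi_mul {r : ℝ} (hr : |r| ≤ 1 / 2) :
    2 * |r| ≤ |Real.sin (Real.pi * r)| := by
  have h := Real.mul_abs_le_abs_sin (x := Real.pi * r) (by
    rw [abs_mul, abs_of_pos Real.pi_pos]; nlinarith [Real.pi_pos])
  rw [abs_mul, abs_of_pos Real.pi_pos] at h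
  refine le_trans (le_of_eq ?_) h
  field_simp

theorem abs_sum_cos_le {r : ℝ} (hr0 : r ≠ 0) (hr : |r| ≤ 1 / 2) (M : ℕ) :
    |∑ n ∈ Icc (-(M : ℤ)) M, Real.cos (2 * Real.pi * n * r)| ≤ 1 / (2 * |r|) := by
  have hpos : 0 < |r| := abs_pos.2 hr0
  rw [le_div_iff₀ (by positivity)]
  have h1 := congrArg abs (sin_mul_sum_cos r M)
  rw [abs_mul] at h1
  have h2 := Real.abs_sin_le_one ((2 * M + 1) * (Real.pi * r))
  rw [← h1] at h2
  refine le_trans ?_ h2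
  rw [mul_comm]
  exact mul_le_mul_of_nonneg_right (two_mul_abs_le_abs_sin_pi_mul hr) (abs_nonneg _)

theorem cos_two_pi_mul_le {y : ℝ} (hy : |y| ≤ 1 / 2) :
    Real.cos (2 * Real.pi * y) ≤ 1 - 8 * y ^ 2 := by
  have h := two_mul_abs_le_abs_sin_pi_mul hy
  have h2 : (2 * |y|) ^ 2 ≤ |Real.sin (Real.pi * y)| ^ 2 := by gcongr
  rw [sq_abs, mul_pow, sq_abs] at h2
  have : 2 * Real.pi * y = 2 * (Real.pi * y) := by ring
  rw [this, Real.cos_two_mul']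
  nlinarith [Real.sin_sq_add_cos_sq (Real.pi * y)]

theorem sum_Icc_neg_sq (M : ℕ) :
    ∑ n ∈ Icc (-(M : ℤ)) M, (n : ℝ) ^ 2 = M * (M + 1) * (2 * M + 1) / 3 := by
  induction M with
  | zero => simp
  | succ M ih =>
    rw [sum_Icc_neg_succ, ih]
    push_cast
    ring

/-- A quantitative form of the fact that the average of `cos (2πnθ)` over `|n| ≤ M` is bounded away
from `1` as soon as `M * |θ|` is bounded away from `0`. -/
theorem sum_cos_le {θ : ℝ} (hθ : |θ| ≤ 1 / 2) (M : ℕ) :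
    ∑ n ∈ Icc (-(M : ℤ)) M, Real.cos (2 * Real.pi * n * θ) ≤
      (2 * M + 1) * (1 - min 1 ((M * θ) ^ 2) / 2) := by
  rcases le_or_gt (M * |θ|) (1 / 2) with h | h
  · have h1 : ∀ n ∈ Icc (-(M : ℤ)) M,
        Real.cos (2 * Real.pi * n * θ) ≤ 1 - 8 * θ ^ 2 * (n : ℝ) ^ 2 := by
      intro n hn
      have hn' : |(n : ℝ)| ≤ M := by
        rw [mem_Icc, ← abs_le] at hn
        exact_mod_cast hn
      have := cos_two_pi_mul_le (y := n * θ) (by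
        rw [abs_mul]
        exact (mul_le_mul_of_nonneg_right hn' (abs_nonneg θ)).trans h)
      rw [mul_assoc (2 * Real.pi)]
      linarith [this, mul_pow (n : ℝ) θ 2]
    refine (sum_le_sum h1).trans ?_
    rw [sum_sub_distrib, ← mul_sum, sum_Icc_neg_sq, sum_const, nsmul_eq_mul, card_Icc_neg]
    have h2 := min_le_right 1 ((M * θ) ^ 2)
    have hM : (0 : ℝ) ≤ M := by positivity
    have h3 : (2 * (M : ℝ) + 1) * min 1 ((M * θ) ^ 2) ≤ (2 * M + 1) * (M * θ) ^ 2 := by gcongr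
    have h4 : 0 ≤ θ ^ 2 * M * (2 * M + 1) := by positivity
    have h5 : 0 ≤ (2 * (M : ℝ) + 1) * (M * θ) ^ 2 := by positivity
    nlinarith
  · have hθ0 : θ ≠ 0 := by
      rintro rfl
      norm_num at h
    have hpos := abs_pos.2 hθ0
    refine (le_abs_self _).trans ((abs_sum_cos_le hθ0 hθ M).trans ?_)
    have h2 := min_le_left 1 ((M * θ) ^ 2)
    have h3 : 1 / (2 * |θ|) ≤ M := by
      rw [div_le_iff₀ (by positivity)]
      linarith
    have hM : (0 : ℝ) ≤ M := by positivity
    nlinarith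

theorem sum_abs_cos_le {r : ℝ} (hr : |r| ≤ 1 / 4) (M : ℕ) :
    ∑ n ∈ Icc (-(M : ℤ)) M, |Real.cos (2 * Real.pi * n * r)| ≤
      (2 * M + 1) * (1 - min 1 ((M * r) ^ 2) / 8) := by
  have h1 : ∀ n ∈ Icc (-(M : ℤ)) M, |Real.cos (2 * Real.pi * n * r)| ≤
      3 / 4 + 1 / 4 * Real.cos (2 * Real.pi * n * (2 * r)) := by
    intro n _
    have e : 2 * Real.pi * n * (2 * r) = 2 * (2 * Real.pi * n * r) := by ring
    rw [e, Real.cos_two_mul, ← sq_abs]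
    nlinarith [sq_nonneg (1 - |Real.cos (2 * Real.pi * n * r)|)]
  refine (sum_le_sum h1).trans ?_
  rw [sum_add_distrib, ← mul_sum, sum_const, nsmul_eq_mul, card_Icc_neg]
  have h2 := sum_cos_le (θ := 2 * r) (by rw [abs_mul, abs_two]; linarith) M
  have h3 : min 1 ((M * r) ^ 2) ≤ min 1 ((M * (2 * r)) ^ 2) :=
    min_le_min_left _ (by nlinarith [sq_nonneg (M * r)])
  have h4 : (2 * (M : ℝ) + 1) * min 1 ((M * r) ^ 2) ≤ (2 * M + 1) * min 1 ((M * (2 * r)) ^ 2) := by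
    gcongr
  nlinarith

end Dirichlet

/-! ### From exponential sums to products of cosines -/

section CosWeight

variable {ι : Type*}

/-- The weight `∏ i ∈ S, |cos (2π x_i r_i)|`. -/
noncomputable def cosWeight (r : ι → ℝ) (S : Finset ι) (x : ι → ℤ) : ℝ :=
  ∏ i ∈ S, |Real.cos (2 * Real.pi * x i * r i)|

theorem cosWeight_nonneg (r : ι → ℝ) (S : Finset ι) (x : ι → ℤ) : 0 ≤ cosWeight r S x :=
  prod_nonneg fun _ _ => abs_nonneg _

theorem cosWeight_le_one (r : ι → ℝ) (S : Finset ι) (x : ι → ℤ) : cosWeight r S x ≤ 1 :=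
  prod_le_one (fun _ _ => abs_nonneg _) fun _ _ => Real.abs_cos_le_one _

theorem cosWeight_update [DecidableEq ι] (r : ι → ℝ) {S : Finset ι} {j : ι} (hj : j ∉ S)
    (x : ι → ℤ) (n : ℤ) :
    cosWeight r S (Function.update x j n) = cosWeight r S x :=
  prod_congr rfl fun i hi => by rw [Function.update_of_ne (ne_of_mem_of_not_mem hi hj)]

theorem cosWeight_comp_swap [DecidableEq ι] (r : ι → ℝ) {S : Finset ι} {i j : ι} (hi : i ∉ S)
    (hj : j ∉ S) (x : ι → ℤ) : cosWeight r S (x ∘ Equiv.swap i j) = cosWeight r S x :=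
  prod_congr rfl fun k hk => by
    rw [Function.comp_apply, Equiv.swap_apply_of_ne_of_ne (ne_of_mem_of_not_mem hk hi)
      (ne_of_mem_of_not_mem hk hj)]

theorem sum_Icc_neg_exp_eq (r : ℝ) (M : ℕ) :
    ∑ n ∈ Icc (-(M : ℤ)) M, Complex.exp (2 * Real.pi * Complex.I * n * r) =
      ∑ n ∈ Icc (-(M : ℤ)) M, ((Real.cos (2 * Real.pi * n * r) : ℝ) : ℂ) := by
  induction M with
  | zero => simp
  | succ M ih =>
    rw [sum_Icc_neg_succ, sum_Icc_neg_succ, ih]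
    congr 1
    push_cast
    have e1 : 2 * (Real.pi : ℂ) * Complex.I * (M + 1) * r =
      (2 * Real.pi * (M + 1) * r) * Complex.I := by ring
    have e2 : 2 * (Real.pi : ℂ) * Complex.I * (-1 + -M) * r =
      -(2 * Real.pi * (M + 1) * r) * Complex.I := by ring
    have e3 : 2 * (Real.pi : ℂ) * (-1 + -M) * r = -(2 * Real.pi * (M + 1) * r) := by ring
    rw [neg_add_rev, e1, e2, e3, Complex.cos_neg, Complex.exp_mul_I, Complex.exp_mul_I,
      Complex.cos_neg, Complex.sin_neg]
    ring

variable [Fintype ι] [DecidableEq ι] {N : ℕ}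

/-- By the invariance of the ball under sign changes of the coordinates, exponentials may be
replaced by cosines. -/
theorem sum_prod_exp_eq_sum_prod_cos (r : ι → ℝ) (T : Finset ι) :
    ∑ x ∈ intBall ι N, ∏ i, Complex.exp (2 * Real.pi * Complex.I * x i * r i) =
      ∑ x ∈ intBall ι N, (∏ i ∈ T, ((Real.cos (2 * Real.pi * x i * r i) : ℝ) : ℂ)) *
        ∏ i ∈ Tᶜ, Complex.exp (2 * Real.pi * Complex.I * x i * r i) := by
  induction T using Finset.induction_on with
  | empty => simp
  | insert j T hj ih =>
    rw [ih, sum_intBall_slice j, sum_intBall_slice j]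
    refine sum_congr rfl fun y _ => ?_
    have hT : Tᶜ = insert j (insert j T)ᶜ := by
      ext i
      simp only [mem_compl, mem_insert]
      by_cases h : i = j <;> simp [h, hj]
    have hj' : j ∉ (insert j T)ᶜ := by simp
    have h1 : ∀ n : ℤ,
        ∏ i ∈ T, ((Real.cos (2 * Real.pi * (Function.update y j n i : ℤ) * r i) : ℝ) : ℂ)
        = ∏ i ∈ T, ((Real.cos (2 * Real.pi * y i * r i) : ℝ) : ℂ) := fun n =>
      prod_congr rfl fun i hi => by rw [Function.update_of_ne (ne_of_mem_of_not_mem hi hj)]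
    have h2 : ∀ n : ℤ, ∏ i ∈ (insert j T)ᶜ,
        Complex.exp (2 * Real.pi * Complex.I * (Function.update y j n i : ℤ) * r i)
        = ∏ i ∈ (insert j T)ᶜ, Complex.exp (2 * Real.pi * Complex.I * y i * r i) := fun n =>
      prod_congr rfl fun i hi => by rw [Function.update_of_ne (ne_of_mem_of_not_mem hi hj')]
    rw [hT]
    simp_rw [prod_insert hj, prod_insert hj', h1, h2, Function.update_self]
    rw [← mul_sum, ← sum_mul, sum_Icc_neg_exp_eq, ← sum_mul, ← sum_mul]
    ring

theorem norm_sum_prod_exp_le (r : ι → ℝ) (S : Finset ι) :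
    ‖∑ x ∈ intBall ι N, ∏ i, Complex.exp (2 * Real.pi * Complex.I * x i * r i)‖ ≤
      ∑ x ∈ intBall ι N, cosWeight r S x := by
  rw [sum_prod_exp_eq_sum_prod_cos r S]
  refine norm_sum_le_of_le _ fun x _ => ?_
  rw [norm_mul, norm_prod, norm_prod]
  have : ∀ i ∈ Sᶜ, ‖Complex.exp (2 * Real.pi * Complex.I * x i * r i)‖ = 1 := fun i _ => by
    rw [Complex.norm_exp]
    simp
  rw [prod_congr rfl this, prod_const_one, mul_one, cosWeight]
  simp only [Complex.norm_real, Real.norm_eq_abs, le_refl]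

/-- With `R = 1 / (2 * |r|)` the left-hand side is the bound for the Dirichlet kernel, which is thus
dominated by the number of points of `[-M, M]` in `[-R, R]`. -/
theorem le_sum_Icc_indicator {R : ℝ} (hR : 1 ≤ R) (M : ℕ) :
    min R (2 * M + 1) ≤ ∑ n ∈ Icc (-(M : ℤ)) M, if |(n : ℝ)| ≤ R then (1 : ℝ) else 0 := by
  rw [← sum_filter, sum_const, nsmul_eq_mul, mul_one]
  have hsub : Icc (-((min M ⌊R⌋₊ : ℕ) : ℤ)) (min M ⌊R⌋₊ : ℕ) ⊆
      {n ∈ Icc (-(M : ℤ)) M | |((n : ℤ) : ℝ)| ≤ R} := by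
    intro n hn
    rw [mem_filter, mem_Icc]
    rw [mem_Icc] at hn
    refine ⟨by omega, ?_⟩
    have h1 : |n| ≤ (⌊R⌋₊ : ℤ) := abs_le.2 (by omega)
    have h2 : |(n : ℝ)| ≤ (⌊R⌋₊ : ℝ) := by exact_mod_cast h1
    exact h2.trans (Nat.floor_le (by linarith))
  have h3 : ((#(Icc (-((min M ⌊R⌋₊ : ℕ) : ℤ)) (min M ⌊R⌋₊ : ℕ)) : ℕ) : ℝ) ≤ _ :=
    Nat.cast_le.2 (card_le_card hsub)
  rw [card_Icc_neg] at h3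
  refine le_trans ?_ h3
  rcases le_total M ⌊R⌋₊ with h | h
  · rw [min_eq_left h]
    exact min_le_right _ _
  · rw [min_eq_right h]
    refine (min_le_left _ _).trans ?_
    have h4 := Nat.lt_floor_add_one R
    have h5 : (1 : ℝ) ≤ ⌊R⌋₊ := by exact_mod_cast Nat.le_floor (by simpa using hR)
    linarith

/-- Summing over the slices in direction `j` first gains the Dirichlet kernel bound
`1 / (2 * |r j|)`; since it is only used where it is smaller than the trivial bound, the gain is
recorded as the restriction of the sum to the points with `|x j| ≤ 1 / (2 * |r j|)`. -/
theorem norm_sum_prod_exp_le_restrict {r : ι → ℝ} {S : Finset ι} {j : ι} (hj : j ∉ S)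
    (hr0 : r j ≠ 0) (hr : |r j| ≤ 1 / 2) :
    ‖∑ x ∈ intBall ι N, ∏ i, Complex.exp (2 * Real.pi * Complex.I * x i * r i)‖ ≤
      ∑ x ∈ intBall ι N, cosWeight r S x * if |(x j : ℝ)| ≤ 1 / (2 * |r j|) then 1 else 0 := by
  have hpos := abs_pos.2 hr0
  rw [sum_prod_exp_eq_sum_prod_cos r (insert j S)]
  refine norm_sum_intBall_le_of_slice j fun y _ => ?_
  have hj' : j ∉ (insert j S)ᶜ := by simp
  set M := sliceRadius N j y
  have h2 : ∀ n : ℤ, ∏ i ∈ (insert j S)ᶜ,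
      Complex.exp (2 * Real.pi * Complex.I * (Function.update y j n i : ℤ) * r i)
      = ∏ i ∈ (insert j S)ᶜ, Complex.exp (2 * Real.pi * Complex.I * y i * r i) := fun n =>
    prod_congr rfl fun i hi => by rw [Function.update_of_ne (ne_of_mem_of_not_mem hi hj')]
  have h1 : ∀ n : ℤ,
      ∏ i ∈ S, ((Real.cos (2 * Real.pi * (Function.update y j n i : ℤ) * r i) : ℝ) : ℂ)
      = ∏ i ∈ S, ((Real.cos (2 * Real.pi * y i * r i) : ℝ) : ℂ) := fun n =>
    prod_congr rfl fun i hi => by rw [Function.update_of_ne (ne_of_mem_of_not_mem hi hj)]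
  have h3 : ‖∏ i ∈ (insert j S)ᶜ, Complex.exp (2 * Real.pi * Complex.I * y i * r i)‖ = 1 := by
    rw [norm_prod]
    refine prod_eq_one fun i _ => ?_
    rw [Complex.norm_exp]
    simp
  have h4 : ‖∏ i ∈ S, ((Real.cos (2 * Real.pi * y i * r i) : ℝ) : ℂ)‖ = cosWeight r S y := by
    rw [norm_prod, cosWeight]
    simp only [Complex.norm_real, Real.norm_eq_abs]
  simp_rw [prod_insert hj, h1, h2, Function.update_self, cosWeight_update r hj]
  rw [← sum_mul, ← sum_mul, ← mul_sum, norm_mul, h3, norm_mul, h4, mul_one, mul_comm,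
    ← Complex.ofReal_sum, Complex.norm_real, Real.norm_eq_abs]
  refine mul_le_mul_of_nonneg_left ?_ (cosWeight_nonneg _ _ _)
  refine le_trans (le_min (abs_sum_cos_le hr0 hr M) ?_) (le_sum_Icc_indicator ?_ M)
  · refine (abs_sum_le_sum_abs _ _).trans
      ((sum_le_card_nsmul _ _ 1 fun n _ => Real.abs_cos_le_one _).trans ?_)
    rw [nsmul_eq_mul, card_Icc_neg, mul_one]
  · rw [le_div_iff₀ (by positivity)]
    linarith

end CosWeight

/-! ### Decay of the average of a product of cosines -/

section Decay

variable {ι : Type*} [Fintype ι] [DecidableEq ι] {N : ℕ}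

/-- The points of the ball more than a quarter of whose coordinates are smaller than `ρ`. -/
noncomputable def fewLarge (ι : Type*) [Fintype ι] [DecidableEq ι] (N : ℕ) (ρ : ℝ) :
    Finset (ι → ℤ) :=
  {x ∈ intBall ι N | Fintype.card ι < 4 * #{i | |(x i : ℝ)| < ρ}}

theorem fewLarge_subset (ρ : ℝ) : fewLarge ι N ρ ⊆ intBall ι N := filter_subset _ _

theorem card_filter_large_ge {ρ : ℝ} {x : ι → ℤ} (hx : x ∈ intBall ι N) (hx' : x ∉ fewLarge ι N ρ)
    (V : Finset ι) :
    (#V : ℝ) - Fintype.card ι / 4 ≤ ∑ i ∈ V, if ρ ≤ |(x i : ℝ)| then (1 : ℝ) else 0 := by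
  have h1 : 4 * #{i | |(x i : ℝ)| < ρ} ≤ Fintype.card ι := by
    by_contra h
    exact hx' (mem_filter.2 ⟨hx, not_le.1 h⟩)
  have h2 : 4 * #{i ∈ V | |(x i : ℝ)| < ρ} ≤ Fintype.card ι :=
    le_trans (by gcongr; exact subset_univ V) h1
  have h3 : #V = #{i ∈ V | ρ ≤ |(x i : ℝ)|} + #{i ∈ V | |(x i : ℝ)| < ρ} := by
    rw [← card_filter_add_card_filter_not (s := V) (fun i => ρ ≤ |(x i : ℝ)|)]
    simp only [not_le]
  rw [← sum_filter, sum_const, nsmul_eq_mul, mul_one, h3]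
  have h2' : (4 : ℝ) * #{i ∈ V | |(x i : ℝ)| < ρ} ≤ Fintype.card ι := by exact_mod_cast h2
  push_cast
  linarith

/-- As the weight does not involve the coordinates outside `S`, these may be permuted, and a
function of one of them may be averaged over all of them. -/
theorem card_compl_mul_sum_cosWeight (r : ι → ℝ) {S : Finset ι} {j : ι} (hj : j ∉ S) (h : ℤ → ℝ) :
    (#Sᶜ : ℝ) * ∑ x ∈ intBall ι N, cosWeight r S x * h (x j) =
      ∑ x ∈ intBall ι N, cosWeight r S x * ∑ i ∈ Sᶜ, h (x i) := by
  simp_rw [mul_sum (Sᶜ)]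
  rw [sum_comm, ← nsmul_eq_mul, ← sum_const]
  refine sum_congr rfl fun i hi => ?_
  rw [← sum_intBall_comp_swap i j]
  refine sum_congr rfl fun x _ => ?_
  rw [cosWeight_comp_swap r (mem_compl.1 hi) hj]
  simp

/-- One coordinate gains the factor `1 - min 1 ((ρ * r j) ^ 2) / 16`. On each slice in direction `j`
the average of `|cos (2π x_j r_j)|` gains whenever the slice contains a point with `ρ ≤ |x j|`; by
symmetry `j` may be exchanged with any coordinate outside `S`, and except on `fewLarge` at least
half of those are of size at least `ρ`. -/
theorem sum_cosWeight_insert_le {r : ι → ℝ} {S : Finset ι} {j : ι} (hj : j ∉ S)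
    (hS : 2 * #S ≤ Fintype.card ι) (hr : |r j| ≤ 1 / 4) {ρ : ℝ} (hρ : 0 ≤ ρ) :
    ∑ x ∈ intBall ι N, cosWeight r (insert j S) x ≤
      (1 - min 1 ((ρ * r j) ^ 2) / 16) * ∑ x ∈ intBall ι N, cosWeight r S x +
        min 1 ((ρ * r j) ^ 2) / 16 * #(fewLarge ι N ρ) := by
  set b := min 1 ((ρ * r j) ^ 2) / 16 with hb
  have hb0 : 0 ≤ b := by positivity
  set h : ℤ → ℝ := fun n => 1 - 2 * b * if ρ ≤ |(n : ℝ)| then 1 else 0 with hh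
  -- `h` records the gain on a slice as a function of `x j` alone: it is less than `1` only where
  -- `ρ ≤ |n|`, so short slices gain nothing and long slices gain at most what the cosine gains.
  have step1 : ∑ x ∈ intBall ι N, cosWeight r (insert j S) x ≤
      ∑ x ∈ intBall ι N, cosWeight r S x * h (x j) := by
    refine sum_intBall_le_of_slice j fun y _ => ?_
    set M := sliceRadius N j y
    have e : ∀ n : ℤ, cosWeight r (insert j S) (Function.update y j n) =
        cosWeight r S y * |Real.cos (2 * Real.pi * n * r j)| := fun n => by
      have := cosWeight_update r hj y n
      unfold cosWeight at this ⊢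
      rw [prod_insert hj, this, Function.update_self, mul_comm]
    simp_rw [e, cosWeight_update r hj, Function.update_self]
    rw [← mul_sum, ← mul_sum]
    refine mul_le_mul_of_nonneg_left ?_ (cosWeight_nonneg _ _ _)
    rcases lt_or_ge (M : ℝ) ρ with hM | hM
    · refine sum_le_sum fun n hn => ?_
      have hn' : |(n : ℝ)| ≤ M := by
        rw [mem_Icc, ← abs_le] at hn
        exact_mod_cast hn
      have : ¬ ρ ≤ |(n : ℝ)| := by linarith
      simpa [hh, this] using Real.abs_cos_le_one _
    · refine (sum_abs_cos_le hr M).trans ?_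
      have h1 : min 1 ((ρ * r j) ^ 2) ≤ min 1 ((M * r j) ^ 2) := by
        refine min_le_min_left _ ?_
        rw [mul_pow, mul_pow]
        gcongr
      calc (2 * (M : ℝ) + 1) * (1 - min 1 ((M * r j) ^ 2) / 8) ≤ (2 * M + 1) * (1 - 2 * b) := by
            refine mul_le_mul_of_nonneg_left ?_ (by positivity)
            rw [hb]
            linarith
        _ = ∑ n ∈ Icc (-(M : ℤ)) M, (1 - 2 * b) := by
            rw [sum_const, nsmul_eq_mul, card_Icc_neg]
        _ ≤ _ := by
            refine sum_le_sum fun n _ => ?_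
            rw [hh]
            dsimp only
            split_ifs <;> linarith
  have hcard : (#Sᶜ : ℝ) = Fintype.card ι - #S := by
    rw [card_compl, Nat.cast_sub (card_le_univ S)]
  have hcpos : (0 : ℝ) < #Sᶜ := by
    exact_mod_cast card_pos.2 ⟨j, mem_compl.2 hj⟩
  have hS' : (2 : ℝ) * #S ≤ Fintype.card ι := by exact_mod_cast hS
  refine step1.trans (le_of_mul_le_mul_left ?_ hcpos)
  rw [card_compl_mul_sum_cosWeight r hj]
  have step2 : ∀ x ∈ intBall ι N, cosWeight r S x * ∑ i ∈ Sᶜ, h (x i) ≤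
      #Sᶜ * ((1 - b) * cosWeight r S x + b * if x ∈ fewLarge ι N ρ then 1 else 0) := by
    intro x hx
    have e : ∑ i ∈ Sᶜ, h (x i) =
        #Sᶜ - 2 * b * ∑ i ∈ Sᶜ, if ρ ≤ |(x i : ℝ)| then (1 : ℝ) else 0 := by
      rw [hh, sum_sub_distrib, ← mul_sum]
      simp
    have hF0 := cosWeight_nonneg r S x
    have hF1 := cosWeight_le_one r S x
    rw [e]
    by_cases hx' : x ∈ fewLarge ι N ρ
    · have h0 : 0 ≤ ∑ i ∈ Sᶜ, if ρ ≤ |(x i : ℝ)| then (1 : ℝ) else 0 :=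
        sum_nonneg fun i _ => by split_ifs <;> norm_num
      rw [if_pos hx']
      have h2 : cosWeight r S x * (#Sᶜ - 2 * b * ∑ i ∈ Sᶜ, if ρ ≤ |(x i : ℝ)| then (1 : ℝ) else 0) ≤
          cosWeight r S x * #Sᶜ := by
        refine mul_le_mul_of_nonneg_left ?_ hF0
        nlinarith [mul_nonneg hb0 h0]
      refine h2.trans ?_
      nlinarith [mul_nonneg hb0 hcpos.le, mul_nonneg (mul_nonneg hb0 hcpos.le) (sub_nonneg.2 hF1)]
    · rw [if_neg hx', mul_zero, add_zero]
      have h1 := card_filter_large_ge hx hx' Sᶜ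
      have h2 : (#Sᶜ : ℝ) / 2 ≤ ∑ i ∈ Sᶜ, if ρ ≤ |(x i : ℝ)| then (1 : ℝ) else 0 := by
        linarith
      have h3 := mul_le_mul_of_nonneg_left h2 hb0
      calc _ ≤ cosWeight r S x * (#Sᶜ * (1 - b)) := by
            refine mul_le_mul_of_nonneg_left ?_ hF0
            linarith
        _ = _ := by ring
  refine (sum_le_sum step2).trans (le_of_eq ?_)
  rw [← mul_sum, sum_add_distrib, ← mul_sum, ← mul_sum, sum_ite_mem,
    inter_eq_right.2 (fewLarge_subset ρ)]
  simp

/-- Each of the steps `sum_cosWeight_insert_le` is a convex combination, so that the contribution of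
`fewLarge` does not accumulate. -/
theorem sum_cosWeight_le {r : ι → ℝ} {S : Finset ι} (hS : 2 * #S ≤ Fintype.card ι)
    (hr : ∀ i ∈ S, |r i| ≤ 1 / 4) {ρ : ℝ} (hρ : 0 ≤ ρ) :
    ∑ x ∈ intBall ι N, cosWeight r S x ≤
      Real.exp (-(∑ i ∈ S, min 1 ((ρ * r i) ^ 2)) / 16) * #(intBall ι N) + #(fewLarge ι N ρ) := by
  induction S using Finset.induction_on with
  | empty => simp [cosWeight]
  | insert j S hj ih =>
    rw [card_insert_of_notMem hj] at hS
    specialize ih (by omega) fun i hi => hr i (mem_insert_of_mem hi)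
    have h := sum_cosWeight_insert_le (N := N) hj (by omega) (hr j (mem_insert_self j S)) hρ
    rw [sum_insert hj]
    set b := min 1 ((ρ * r j) ^ 2) / 16 with hb
    have hb0 : 0 ≤ b := by positivity
    have hb1 : b ≤ 1 / 16 := by
      have := min_le_left 1 ((ρ * r j) ^ 2)
      rw [hb]
      linarith
    have hexp : 1 - b ≤ Real.exp (-b) := by
      have := Real.add_one_le_exp (-b)
      linarith
    have e : Real.exp (-(min 1 ((ρ * r j) ^ 2) + ∑ i ∈ S, min 1 ((ρ * r i) ^ 2)) / 16) =
        Real.exp (-b) * Real.exp (-(∑ i ∈ S, min 1 ((ρ * r i) ^ 2)) / 16) := by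
      rw [← Real.exp_add, hb]
      ring_nf
    rw [e]
    set X := Real.exp (-(∑ i ∈ S, min 1 ((ρ * r i) ^ 2)) / 16) * #(intBall ι N)
    have hX : 0 ≤ X := by positivity
    calc _ ≤ _ := h
      _ ≤ (1 - b) * (X + #(fewLarge ι N ρ)) + b * #(fewLarge ι N ρ) := by
        have : 0 ≤ 1 - b := by linarith
        gcongr
      _ = (1 - b) * X + #(fewLarge ι N ρ) := by ring
      _ ≤ Real.exp (-b) * X + #(fewLarge ι N ρ) := by gcongr
      _ = _ := by ring

end Decay

/-! ### Points with one small coordinate -/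

section SmallCoordinate

variable {ι : Type*} [Fintype ι] [DecidableEq ι] {N : ℕ}

theorem sum_Icc_indicator_le {R : ℝ} (hR : 0 ≤ R) (M : ℕ) :
    ∑ n ∈ Icc (-(M : ℤ)) M, (if |(n : ℝ)| ≤ R then (1 : ℝ) else 0) ≤ 2 * R + 1 := by
  rw [← sum_filter, sum_const, nsmul_eq_mul, mul_one]
  have hsub : {n ∈ Icc (-(M : ℤ)) M | |((n : ℤ) : ℝ)| ≤ R} ⊆ Icc (-(⌊R⌋₊ : ℤ)) ⌊R⌋₊ := by
    intro n hn
    rw [mem_filter] at hn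
    rw [mem_Icc, ← abs_le, ← Int.natCast_natAbs, Nat.cast_le]
    refine Nat.le_floor ?_
    rw [Nat.cast_natAbs]
    exact_mod_cast hn.2
  have h3 := Nat.cast_le (α := ℝ).2 (card_le_card hsub)
  rw [card_Icc_neg] at h3
  linarith [Nat.floor_le hR]

/-- Points with a large `i`-th coordinate are traded, slice by slice in direction `i`, for points
at a definite distance from the boundary of the ball. -/
theorem sum_large_coord_le (G : (ι → ℤ) → ℝ) {i : ι} (hG0 : ∀ x, 0 ≤ G x)
    (hG : ∀ x n, G (Function.update x i n) = G x) {ρ : ℝ} (hρ : 0 < ρ) :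
    ∑ x ∈ intBall ι N, G x * (if ρ ≤ |(x i : ℝ)| then 1 else 0) ≤
      4 * ∑ x ∈ intBall ι N,
        G x * if ρ ^ 2 ≤ 4 * ((((N : ℤ) ^ 2 - ∑ k, x k ^ 2 : ℤ)) : ℝ) then 1 else 0 := by
  rw [mul_sum]
  refine sum_intBall_le_of_slice i fun y hy => ?_
  set M := sliceRadius N i y with hM
  simp_rw [← room_sub_sq i, room_update, hG, Function.update_self]
  rw [← mul_sum, ← mul_sum, ← mul_sum, mul_left_comm]
  refine mul_le_mul_of_nonneg_left ?_ (hG0 _)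
  have hM2 : (M : ℤ) ^ 2 ≤ room N i y := (sq_le_room_iff (room_nonneg hy) _).2 (by simp [hM])
  have hM2' : (M : ℝ) ^ 2 ≤ room N i y := by exact_mod_cast hM2
  rcases lt_or_ge (M : ℝ) ρ with h | h
  · rw [sum_eq_zero fun n hn => ?_]
    · exact mul_nonneg (by norm_num) (sum_nonneg fun n _ => by split_ifs <;> norm_num)
    · have hn' : |(n : ℝ)| ≤ M := by
        rw [mem_Icc, ← abs_le] at hn
        exact_mod_cast hn
      rw [if_neg (by linarith)]
  · have h1 : ∑ n ∈ Icc (-(M : ℤ)) M, (if ρ ≤ |(n : ℝ)| then (1 : ℝ) else 0) ≤ 2 * M + 1 := by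
      refine (sum_le_card_nsmul _ _ 1 fun n _ => by split_ifs <;> norm_num).trans ?_
      rw [nsmul_eq_mul, card_Icc_neg, mul_one]
    have h2 : (2 * ((M / 2 : ℕ) : ℝ) + 1) ≤ ∑ n ∈ Icc (-(M : ℤ)) M,
        if ρ ^ 2 ≤ 4 * ((room N i y - n ^ 2 : ℤ) : ℝ) then (1 : ℝ) else 0 := by
      rw [← card_Icc_neg, ← sum_filter, sum_const, nsmul_eq_mul, mul_one, Nat.cast_le]
      refine card_le_card fun n hn => ?_
      rw [mem_Icc] at hn
      rw [mem_filter, mem_Icc]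
      refine ⟨by omega, ?_⟩
      have hn2 : |2 * n| ≤ (M : ℤ) := abs_le.2 (by omega)
      have hn3 : (2 * n) ^ 2 ≤ (M : ℤ) ^ 2 := sq_le_sq' (abs_le.1 hn2).1 (abs_le.1 hn2).2
      have hn4 : (2 * (n : ℝ)) ^ 2 ≤ (M : ℝ) ^ 2 := by exact_mod_cast hn3
      push_cast
      nlinarith
    have h3 : (2 * M + 1 : ℝ) ≤ 4 * (2 * ((M / 2 : ℕ) : ℝ) + 1) := by
      have : 2 * M + 1 ≤ 4 * (2 * (M / 2) + 1) := by omega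
      exact_mod_cast this
    linarith

/-- Away from the boundary of the ball the slices in direction `j` are long, so that few of their
points have `|x j| ≤ R`. -/
theorem sum_small_coord_le (G : (ι → ℤ) → ℝ) {j : ι} (hG0 : ∀ x, 0 ≤ G x)
    (hG : ∀ x n, G (Function.update x j n) = G x) {ρ : ℝ} (hρ : 0 < ρ) {R : ℝ} (hR : 0 ≤ R) :
    ∑ x ∈ intBall ι N, G x * (if |(x j : ℝ)| ≤ R then 1 else 0) *
        (if ρ ^ 2 ≤ 4 * ((((N : ℤ) ^ 2 - ∑ k, x k ^ 2 : ℤ)) : ℝ) then 1 else 0) ≤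
      2 * (2 * R + 1) / ρ * ∑ x ∈ intBall ι N, G x := by
  rw [mul_sum]
  refine sum_intBall_le_of_slice j fun y hy => ?_
  set M := sliceRadius N j y with hM
  simp_rw [← room_sub_sq j, room_update, hG, Function.update_self, mul_assoc (G y)]
  rw [← mul_sum, sum_const, nsmul_eq_mul, card_Icc_neg, ← mul_assoc, mul_comm _ (G y)]
  refine mul_le_mul_of_nonneg_left ?_ (hG0 _)
  have hM2 : room N j y < ((M : ℤ) + 1) ^ 2 := by
    by_contra hcon
    have := (sq_le_room_iff (room_nonneg hy) ((M : ℤ) + 1)).1 (not_lt.1 hcon)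
    rw [mem_Icc] at this
    omega
  have hM2' : (room N j y : ℝ) < ((M : ℝ) + 1) ^ 2 := by exact_mod_cast hM2
  have hM0 : (0 : ℝ) ≤ M := by positivity
  rcases le_or_gt ρ (2 * (2 * M + 1)) with h | h
  · have h1 : ∑ n ∈ Icc (-(M : ℤ)) M, (if |(n : ℝ)| ≤ R then (1 : ℝ) else 0) *
        (if ρ ^ 2 ≤ 4 * ((room N j y - n ^ 2 : ℤ) : ℝ) then (1 : ℝ) else 0) ≤ 2 * R + 1 := by
      refine (sum_le_sum fun n _ => ?_).trans (sum_Icc_indicator_le hR M)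
      split_ifs <;> norm_num
    refine h1.trans ?_
    rw [mul_div_assoc', le_div_iff₀ hρ]
    nlinarith
  · rw [sum_eq_zero fun n _ => ?_]
    · positivity
    · have hn : ¬ ρ ^ 2 ≤ 4 * ((room N j y - n ^ 2 : ℤ) : ℝ) := by
        push_cast
        nlinarith [sq_nonneg (n : ℝ)]
      rw [if_neg hn, mul_zero]

/-- The points with `|x j| ≤ R` carry at most a proportion `O(R / ρ)` of the weight, up to
the contribution of `fewLarge`: for the other points a fixed proportion of the coordinates `i` lies
outside `S` and has size at least `ρ`, and within the two-dimensional slices in the directions `i` and `j` the condition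
`|x j| ≤ R` is rare. -/
theorem sum_cosWeight_restrict_le (r : ι → ℝ) {S : Finset ι} {j : ι} (hj : j ∉ S)
    (hS : 2 * #S ≤ Fintype.card ι) (hd : 8 ≤ Fintype.card ι) {ρ : ℝ} (hρ : 0 < ρ) {R : ℝ}
    (hR : 0 ≤ R) :
    ∑ x ∈ intBall ι N, cosWeight r S x * (if |(x j : ℝ)| ≤ R then 1 else 0) ≤
      64 * (2 * R + 1) / ρ * ∑ x ∈ intBall ι N, cosWeight r S x + #(fewLarge ι N ρ) := by
  set d : ℝ := ((Fintype.card ι : ℕ) : ℝ) with hdef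
  have hd' : (8 : ℝ) ≤ d := by rw [hdef]; exact_mod_cast hd
  have hS' : (2 : ℝ) * #S ≤ d := by rw [hdef]; exact_mod_cast hS
  set U := (insert j S)ᶜ with hU
  have hcard : (#U : ℝ) = d - (#S + 1) := by
    rw [hU, card_compl, Nat.cast_sub (card_le_univ _), card_insert_of_notMem hj]
    push_cast
    rfl
  set Φ := ∑ x ∈ intBall ι N, cosWeight r S x
  have hΦ : 0 ≤ Φ := sum_nonneg fun x _ => cosWeight_nonneg r S x
  set W : (ι → ℤ) → ℝ := fun x => cosWeight r S x * (if |(x j : ℝ)| ≤ R then 1 else 0) with hW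
  have hW0 : ∀ x, 0 ≤ W x := fun x =>
    mul_nonneg (cosWeight_nonneg _ _ _) (by split_ifs <;> norm_num)
  have hW1 : ∀ x, W x ≤ 1 := fun x =>
    mul_le_one₀ (cosWeight_le_one _ _ _) (by split_ifs <;> norm_num) (by split_ifs <;> norm_num)
  have hpair : ∀ i ∈ U, ∑ x ∈ intBall ι N, W x * (if ρ ≤ |(x i : ℝ)| then 1 else 0) ≤
      8 * (2 * R + 1) / ρ * Φ := by
    intro i hi
    rw [hU, mem_compl, mem_insert, not_or] at hi
    have hij : j ≠ i := Ne.symm hi.1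
    refine (sum_large_coord_le W hW0 (fun x n => ?_) hρ).trans ?_
    · rw [hW]
      dsimp only
      rw [cosWeight_update r hi.2, Function.update_of_ne hij]
    · have h1 := sum_small_coord_le (N := N) (cosWeight r S) (cosWeight_nonneg r S)
        (cosWeight_update r hj) hρ hR
      refine (mul_le_mul_of_nonneg_left h1 (by norm_num)).trans (le_of_eq ?_)
      ring
  have hpoint : ∀ x ∈ intBall ι N, W x ≤
      8 / d * ∑ i ∈ U, W x * (if ρ ≤ |(x i : ℝ)| then 1 else 0) +
        if x ∈ fewLarge ι N ρ then 1 else 0 := by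
    intro x hx
    rw [← mul_sum]
    by_cases hx' : x ∈ fewLarge ι N ρ
    · rw [if_pos hx']
      have h0 : 0 ≤ ∑ i ∈ U, if ρ ≤ |(x i : ℝ)| then (1 : ℝ) else 0 :=
        sum_nonneg fun i _ => by split_ifs <;> norm_num
      have h1 : 0 ≤ 8 / d * (W x * ∑ i ∈ U, if ρ ≤ |(x i : ℝ)| then (1 : ℝ) else 0) :=
        mul_nonneg (by positivity) (mul_nonneg (hW0 x) h0)
      linarith [hW1 x]
    · rw [if_neg hx', add_zero]
      have h1 := card_filter_large_ge hx hx' U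
      have h2 : d / 8 ≤ ∑ i ∈ U, if ρ ≤ |(x i : ℝ)| then (1 : ℝ) else 0 := by linarith
      calc W x = 8 / d * (W x * (d / 8)) := by field_simp
        _ ≤ _ := by
          have := hW0 x
          gcongr
  refine (sum_le_sum hpoint).trans ?_
  rw [sum_add_distrib, ← mul_sum, sum_comm, sum_ite_mem, inter_eq_right.2 (fewLarge_subset ρ),
    sum_const, nsmul_one]
  refine add_le_add ?_ le_rfl
  calc 8 / d * ∑ i ∈ U, ∑ x ∈ intBall ι N, W x * (if ρ ≤ |(x i : ℝ)| then 1 else 0)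
      ≤ 8 / d * (d * (8 * (2 * R + 1) / ρ * Φ)) := by
        have h1 := sum_le_card_nsmul _ _ _ hpair
        rw [nsmul_eq_mul] at h1
        refine mul_le_mul_of_nonneg_left (h1.trans ?_) (by positivity)
        refine mul_le_mul_of_nonneg_right ?_ (by positivity)
        have : (0 : ℝ) ≤ #S := by positivity
        linarith
    _ = _ := by
        field_simp
        ring

end SmallCoordinate

/-! ### Points with few large coordinates -/

section Chernoff

variable {ι : Type*} [Fintype ι] [DecidableEq ι] {N : ℕ}

/-- The ball contains the integer points of the cube `[-κ, κ] ^ d`. -/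
theorem pow_card_le_card_intBall {κ : ℝ} (hκ : 0 < κ) (h : κ ^ 2 * Fintype.card ι = (N : ℝ) ^ 2) :
    κ ^ Fintype.card ι ≤ #(intBall ι N) := by
  have hsub : Fintype.piFinset (fun _ : ι => Icc (-(⌊κ⌋₊ : ℤ)) ⌊κ⌋₊) ⊆ intBall ι N := by
    intro x hx
    rw [Fintype.mem_piFinset] at hx
    rw [mem_intBall]
    have h1 : ∀ i, (x i : ℝ) ^ 2 ≤ κ ^ 2 := fun i => by
      have h2 := hx i
      rw [mem_Icc, ← abs_le] at h2
      have h3 : |(x i : ℝ)| ≤ ⌊κ⌋₊ := by exact_mod_cast h2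
      exact sq_le_sq' (abs_le.1 (h3.trans (Nat.floor_le hκ.le))).1
        (abs_le.1 (h3.trans (Nat.floor_le hκ.le))).2
    have h2 : ∑ i, (x i : ℝ) ^ 2 ≤ (N : ℝ) ^ 2 := by
      refine (sum_le_card_nsmul univ _ _ fun i _ => h1 i).trans ?_
      rw [nsmul_eq_mul, card_univ, ← h, mul_comm]
    exact_mod_cast h2
  have h3 := Nat.cast_le (α := ℝ).2 (card_le_card hsub)
  rw [Fintype.card_piFinset, prod_const, card_univ, Nat.cast_pow, card_Icc_neg] at h3
  refine le_trans (pow_le_pow_left₀ hκ.le ?_ _) h3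
  have := Nat.lt_floor_add_one κ
  have : (0 : ℝ) ≤ ⌊κ⌋₊ := by positivity
  linarith

theorem sum_Icc_exp_le {κ : ℝ} (hκ : 0 < κ) (N : ℕ) :
    ∑ n ∈ Icc (-(N : ℤ)) N, Real.exp (1 - |(n : ℝ)| / κ) ≤ Real.exp 1 * (2 * (κ + 1)) := by
  set q := Real.exp (-(1 / κ)) with hq
  have hq1 : q * (1 + 1 / κ) ≤ 1 := by
    have h1 := Real.add_one_le_exp (1 / κ)
    have h2 : q * Real.exp (1 / κ) = 1 := by rw [hq, ← Real.exp_add]; simp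
    have h3 : 0 < q := Real.exp_pos _
    nlinarith
  have hq0 : 0 < q := Real.exp_pos _
  have hq2 : q * (κ + 1) ≤ κ := by
    have : q * (κ + 1) = κ * (q * (1 + 1 / κ)) := by field_simp
    rw [this]
    nlinarith
  have hterm : ∀ n : ℤ, Real.exp (1 - |(n : ℝ)| / κ) = Real.exp 1 * q ^ n.natAbs := fun n => by
    rw [hq, ← Real.exp_nat_mul, ← Real.exp_add, Nat.cast_natAbs]
    congr 1
    push_cast
    ring
  simp_rw [hterm]
  rw [← mul_sum]
  refine mul_le_mul_of_nonneg_left ?_ (Real.exp_pos _).le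
  -- The right-hand side grows by at least `2 * q ^ (N + 1)` at each step because `q ≤ κ / (κ + 1)`.
  have hsum : ∀ N : ℕ, ∑ n ∈ Icc (-(N : ℤ)) N, q ^ n.natAbs ≤ 2 * (κ + 1) * (1 - q ^ (N + 1)) := by
    intro N
    induction N with
    | zero => simp; nlinarith
    | succ N ih =>
      rw [sum_Icc_neg_succ]
      have e1 : ((N : ℤ) + 1).natAbs = N + 1 := by omega
      have e2 : (-((N : ℤ) + 1)).natAbs = N + 1 := by omega
      rw [e1, e2, pow_succ q (N + 1)]
      have : 0 < q ^ (N + 1) := by positivity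
      nlinarith
  refine (hsum N).trans ?_
  have : 0 < q ^ (N + 1) := by positivity
  nlinarith

/-- Exponential moment bound for the points more than a quarter of whose coordinates are small
compared to `κ`. On the ball `∑ i, (1 - |x i| / κ)` is nonnegative, and on `fewLarge` the product
of the factors `2 ^ 20` over the small coordinates is at least `32 ^ d`; hence the indicator of
`fewLarge` is at most a product of functions of one coordinate each,
each of total mass at most `κ / 2`; the ball itself has at least `κ ^ d` points. -/
theorem two_pow_mul_card_fewLarge_le {κ : ℝ} (hκ : 2 ^ 22 ≤ κ)
    (h : κ ^ 2 * Fintype.card ι = (N : ℝ) ^ 2) :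
    2 ^ Fintype.card ι * (#(fewLarge ι N (κ / 2 ^ 22)) : ℝ) ≤ #(intBall ι N) := by
  have hκ0 : 0 < κ := by linarith
  set ρ := κ / 2 ^ 22 with hρ
  set w : ℤ → ℝ := fun n =>
    Real.exp (1 - |(n : ℝ)| / κ) * (if |(n : ℝ)| < ρ then 2 ^ 20 else 1) / 32 with hw
  have hw0 : ∀ n, 0 ≤ w n := fun n => by
    rw [hw]
    dsimp only
    split_ifs <;> positivity
  have hpoint : ∀ x ∈ fewLarge ι N ρ, 1 ≤ ∏ i, w (x i) := by
    intro x hx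
    rw [fewLarge, mem_filter, mem_intBall] at hx
    obtain ⟨hx1, hx2⟩ := hx
    have h1 : ∑ i, (x i : ℝ) ^ 2 ≤ κ ^ 2 * Fintype.card ι := by
      rw [h]
      exact_mod_cast hx1
    have h2 : 0 ≤ ∑ i, (1 - |(x i : ℝ)| / κ) := by
      -- `1 - u ^ 2 ≤ 2 * (1 - u)` passes to the exponent linear in `|x i|`, whose sum is geometric.
      have h3 : ∑ i, (1 - (x i : ℝ) ^ 2 / κ ^ 2) ≤ ∑ i, 2 * (1 - |(x i : ℝ)| / κ) := by
        refine sum_le_sum fun i _ => ?_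
        rw [← sq_abs (x i : ℝ), ← div_pow]
        nlinarith [sq_nonneg (|(x i : ℝ)| / κ - 1)]
      rw [← mul_sum, sum_sub_distrib, ← sum_div] at h3
      have h4 : (∑ i, (x i : ℝ) ^ 2) / κ ^ 2 ≤ Fintype.card ι := by
        rw [div_le_iff₀ (by positivity)]
        linarith
      simp only [sum_const, card_univ, nsmul_eq_mul, mul_one] at h3
      linarith
    rw [hw, prod_div_distrib, prod_mul_distrib, ← Real.exp_sum, prod_const, card_univ,
      prod_ite, prod_const_one, mul_one, prod_const, le_div_iff₀ (by positivity), one_mul]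
    have h5 : (32 : ℝ) ^ Fintype.card ι ≤ (2 ^ 20) ^ #{i | |(x i : ℝ)| < ρ} := by
      have e : ((2 : ℝ) ^ 20) = 32 ^ 4 := by norm_num
      rw [e, ← pow_mul]
      exact pow_le_pow_right₀ (by norm_num) hx2.le
    have h6 := Real.one_le_exp h2
    have h7 : (0 : ℝ) ≤ (2 ^ 20) ^ #{i | |(x i : ℝ)| < ρ} := by positivity
    exact h5.trans (le_mul_of_one_le_left h7 h6)
  have hsub : fewLarge ι N ρ ⊆ Fintype.piFinset fun _ : ι => Icc (-(N : ℤ)) N :=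
    (fewLarge_subset ρ).trans (filter_subset _ _)
  have hsum : (#(fewLarge ι N ρ) : ℝ) ≤ (∑ n ∈ Icc (-(N : ℤ)) N, w n) ^ Fintype.card ι := by
    calc (#(fewLarge ι N ρ) : ℝ) = ∑ x ∈ fewLarge ι N ρ, 1 := by simp
      _ ≤ ∑ x ∈ fewLarge ι N ρ, ∏ i, w (x i) := sum_le_sum hpoint
      _ ≤ ∑ x ∈ Fintype.piFinset fun _ : ι => Icc (-(N : ℤ)) N, ∏ i, w (x i) :=
        sum_le_sum_of_subset_of_nonneg hsub fun x _ _ => prod_nonneg fun i _ => hw0 _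
      _ = _ := by
        rw [← prod_univ_sum (fun _ : ι => Icc (-(N : ℤ)) N) (fun _ n => w n), prod_const,
          card_univ]
  have hone : ∑ n ∈ Icc (-(N : ℤ)) N, w n ≤ κ / 2 := by
    have h1 : ∀ n ∈ Icc (-(N : ℤ)) N, w n ≤ Real.exp (1 - |(n : ℝ)| / κ) / 32 +
        Real.exp 1 * 2 ^ 15 * if |(n : ℝ)| ≤ ρ then 1 else 0 := by
      intro n _
      rw [hw]
      dsimp only
      by_cases hn : |(n : ℝ)| < ρ
      · rw [if_pos hn, if_pos hn.le]
        have h2 : Real.exp (1 - |(n : ℝ)| / κ) ≤ Real.exp 1 :=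
          Real.exp_le_exp.2 (by have : 0 ≤ |(n : ℝ)| / κ := by positivity
                                linarith)
        have := Real.exp_pos (1 - |(n : ℝ)| / κ)
        linarith
      · rw [if_neg hn, mul_one]
        have : 0 ≤ Real.exp 1 * 2 ^ 15 * (if |(n : ℝ)| ≤ ρ then (1 : ℝ) else 0) := by
          split_ifs <;> positivity
        linarith
    refine (sum_le_sum h1).trans ?_
    rw [sum_add_distrib, ← sum_div, ← mul_sum]
    have h2 := sum_Icc_exp_le hκ0 N
    have h3 := sum_Icc_indicator_le (R := ρ) (by positivity) N
    have he := Real.exp_one_lt_d9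
    have he0 := Real.exp_pos 1
    have h4 : Real.exp 1 * 2 ^ 15 * ∑ n ∈ Icc (-(N : ℤ)) N,
        (if |(n : ℝ)| ≤ ρ then (1 : ℝ) else 0) ≤ Real.exp 1 * 2 ^ 15 * (2 * ρ + 1) := by gcongr
    have h5 : 2 ^ 22 * ρ = κ := by rw [hρ]; field_simp
    have h6 : 2 * (κ + 1) / 32 + 2 ^ 15 * (2 * ρ + 1) ≤ κ / 6 := by
      rw [← h5] at hκ ⊢
      norm_num at hκ ⊢
      linarith
    have h7 : Real.exp 1 * (2 * (κ + 1) / 32 + 2 ^ 15 * (2 * ρ + 1)) ≤ 3 * (κ / 6) := by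
      gcongr
      linarith
    linarith
  have hw0' : 0 ≤ ∑ n ∈ Icc (-(N : ℤ)) N, w n := sum_nonneg fun n _ => hw0 n
  calc 2 ^ Fintype.card ι * (#(fewLarge ι N ρ) : ℝ)
      ≤ 2 ^ Fintype.card ι * (κ / 2) ^ Fintype.card ι := by
        gcongr
        exact hsum.trans (by gcongr)
    _ = κ ^ Fintype.card ι := by rw [← mul_pow]; congr 1; ring
    _ ≤ _ := pow_card_le_card_intBall hκ0 h

end Chernoff

/-! ### The exponential sum over the ball -/

section ExponentialSum

variable {ι : Type*}

theorem exists_subset_half_sum (V : Finset ι) (a : ι → ℝ) :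
    ∃ S ⊆ V, 2 * #S ≤ #V + 1 ∧ ∑ i ∈ V, a i ≤ 2 * ∑ i ∈ S, a i := by
  classical
  obtain ⟨T, hT, hc⟩ := exists_subset_card_eq (Nat.div_le_self #V 2)
  have h1 := sum_sdiff (f := a) hT
  have h2 := card_sdiff_add_card_eq_card hT
  rcases le_total (∑ i ∈ T, a i) (∑ i ∈ V \ T, a i) with h | h
  · exact ⟨V \ T, sdiff_subset, by omega, by linarith⟩
  · exact ⟨T, hT, by omega, by linarith⟩

theorem exp_neg_div_le {A : ℝ} (hA : 0 ≤ A) : Real.exp (-A / 32) ≤ 32 / √(1 + A) := by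
  have h1 := Real.add_one_le_exp (A / 32)
  have h2 : Real.exp (-A / 32) * Real.exp (A / 32) = 1 := by
    rw [← Real.exp_add]
    ring_nf
    exact Real.exp_zero
  have h3 : √(1 + A) ≤ 1 + A := Real.sqrt_le_iff.2 ⟨by linarith, by nlinarith⟩
  have h4 : 0 < √(1 + A) := Real.sqrt_pos.2 (by linarith)
  have h5 := Real.exp_pos (-A / 32)
  rw [le_div_iff₀ h4]
  nlinarith

variable [Fintype ι] [DecidableEq ι] {N : ℕ}

/-- The coordinates other than the largest one enter only through the truncated sum `∑ i ≠ j,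
min 1 ((ρ * r i) ^ 2)`. -/
theorem mul_sqrt_sum_sq_le {r : ι → ℝ} {j : ι} (hmax : ∀ i, |r i| ≤ |r j|) {ρ : ℝ} (hρ : 0 ≤ ρ) :
    ρ * √(∑ i, r i ^ 2) ≤
      max 1 (ρ * |r j|) * √(1 + ∑ i ∈ univ.erase j, min 1 ((ρ * r i) ^ 2)) := by
  set K := max 1 (ρ * |r j|) with hK
  have hK1 : 1 ≤ K := le_max_left _ _
  have hterm : ∀ i, (ρ * r i) ^ 2 ≤ K ^ 2 := fun i => by
    rw [← sq_abs, abs_mul, abs_of_nonneg hρ]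
    refine pow_le_pow_left₀ (by positivity) ?_ 2
    exact (mul_le_mul_of_nonneg_left (hmax i) hρ).trans (le_max_right _ _)
  have hterm' : ∀ i, (ρ * r i) ^ 2 ≤ K ^ 2 * min 1 ((ρ * r i) ^ 2) := fun i => by
    rcases le_total 1 ((ρ * r i) ^ 2) with h | h
    · rw [min_eq_left h, mul_one]
      exact hterm i
    · rw [min_eq_right h]
      exact le_mul_of_one_le_left (sq_nonneg _) (one_le_pow₀ hK1)
  have h : ρ ^ 2 * ∑ i, r i ^ 2 ≤ K ^ 2 * (1 + ∑ i ∈ univ.erase j, min 1 ((ρ * r i) ^ 2)) := by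
    rw [mul_sum, ← add_sum_erase _ _ (mem_univ j), mul_add, mul_one, mul_sum]
    simp_rw [← mul_pow]
    exact add_le_add (hterm j) (sum_le_sum fun i _ => hterm' i)
  rw [← Real.sqrt_sq hρ, ← Real.sqrt_mul (sq_nonneg ρ), Real.sqrt_sq hρ]
  refine (Real.sqrt_le_sqrt h).trans (le_of_eq ?_)
  rw [Real.sqrt_mul (sq_nonneg K), Real.sqrt_sq (by linarith)]

theorem norm_sum_prod_exp_intBall_le {r : ι → ℝ} (hr : ∀ i, |r i| ≤ 1 / 2) (hr0 : r ≠ 0)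
    (hd : 8 ≤ Fintype.card ι) {ρ : ℝ} (hρ : 0 < ρ) :
    ‖∑ x ∈ intBall ι N, ∏ i, Complex.exp (2 * Real.pi * Complex.I * x i * r i)‖ ≤
      (3072 / (ρ * √(∑ i, r i ^ 2)) + 384 / ρ) * #(intBall ι N) + 97 * #(fewLarge ι N ρ) := by
  have : Nonempty ι := Fintype.card_pos_iff.1 (by omega)
  obtain ⟨j, hmax⟩ := Finite.exists_max fun i => |r i|
  have ht : 0 < |r j| := by
    obtain ⟨i, hi⟩ := Function.ne_iff.1 hr0
    exact (abs_pos.2 hi).trans_le (hmax i)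
  set t := |r j| with htdef
  set n : ℝ := ((#(intBall ι N) : ℕ) : ℝ)
  set b : ℝ := ((#(fewLarge ι N ρ) : ℕ) : ℝ)
  have hn : 0 ≤ n := by positivity
  have hb : 0 ≤ b := by positivity
  set l := √(∑ i, r i ^ 2)
  have hl : 0 < l := by
    refine Real.sqrt_pos.2 (sum_pos' (fun i _ => sq_nonneg _) ⟨j, mem_univ j, ?_⟩)
    rw [← sq_abs]
    positivity
  have hrestrict : ∀ S : Finset ι, j ∉ S → 2 * #S ≤ Fintype.card ι →
      ‖∑ x ∈ intBall ι N, ∏ i, Complex.exp (2 * Real.pi * Complex.I * x i * r i)‖ ≤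
        96 / (ρ * t) * ∑ x ∈ intBall ι N, cosWeight r S x + b := by
    intro S hj hS
    refine (norm_sum_prod_exp_le_restrict hj (abs_pos.1 ht) (hr j)).trans
      ((sum_cosWeight_restrict_le r hj hS hd hρ (by positivity)).trans ?_)
    have h0 : 0 ≤ ∑ x ∈ intBall ι N, cosWeight r S x :=
      sum_nonneg fun x _ => cosWeight_nonneg r S x
    gcongr ?_ * _ + _
    rw [div_le_div_iff₀ hρ (by positivity)]
    have h1 : (2 * (1 / (2 * t)) + 1) * t ≤ 3 / 2 := by
      have := hr j
      field_simp
      linarith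
    nlinarith
  rcases le_or_gt (1 / 4) t with h4 | h4
  · -- Here `|r j|` is bounded below, and the Dirichlet kernel alone gives `O(1 / ρ)`.
    have h1 := hrestrict ∅ (by simp) (by simp)
    simp only [cosWeight, prod_empty, sum_const, nsmul_eq_mul, mul_one] at h1
    refine h1.trans ?_
    have h2 : 96 / (ρ * t) ≤ 384 / ρ := by
      rw [div_le_div_iff₀ (by positivity) hρ]
      nlinarith
    have h3 : 0 ≤ 3072 / (ρ * l) := by positivity
    have h5 : 96 / (ρ * t) * n ≤ (3072 / (ρ * l) + 384 / ρ) * n :=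
      mul_le_mul_of_nonneg_right (by linarith) hn
    linarith
  · obtain ⟨S, hSV, hS, hsum⟩ :=
      exists_subset_half_sum (univ.erase j) fun i => min 1 ((ρ * r i) ^ 2)
    rw [card_erase_of_mem (mem_univ j), card_univ] at hS
    have hS' : 2 * #S ≤ Fintype.card ι := by omega
    have hj : j ∉ S := fun h => by simpa using hSV h
    have hl' := mul_sqrt_sum_sq_le hmax hρ.le
    set A := ∑ i ∈ univ.erase j, min 1 ((ρ * r i) ^ 2)
    have hA : 0 ≤ A := sum_nonneg fun i _ => by positivity
    have hsq : 0 < √(1 + A) := Real.sqrt_pos.2 (by linarith)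
    have hΦ := sum_cosWeight_le (N := N) hS' (fun i _ => (hmax i).trans h4.le) hρ.le
    set Φ := ∑ x ∈ intBall ι N, cosWeight r S x
    have hΦ' : Φ ≤ 32 / √(1 + A) * n + b := by
      refine hΦ.trans ?_
      gcongr
      refine (Real.exp_le_exp.2 ?_).trans (exp_neg_div_le hA)
      linarith
    have h384 : 0 ≤ 384 / ρ * n := by positivity
    rcases le_or_gt 1 (ρ * t) with h | h
    · rw [max_eq_right h] at hl'
      have h1 : 96 / (ρ * t) * (32 / √(1 + A)) ≤ 3072 / (ρ * l) := by
        rw [div_mul_div_comm]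
        norm_num only
        gcongr
      have h2 : 96 / (ρ * t) ≤ 96 := div_le_self (by norm_num) h
      calc _ ≤ 96 / (ρ * t) * Φ + b := hrestrict S hj hS'
        _ ≤ 96 / (ρ * t) * (32 / √(1 + A) * n + b) + b := by gcongr
        _ = 96 / (ρ * t) * (32 / √(1 + A)) * n + 96 / (ρ * t) * b + b := by ring
        _ ≤ 3072 / (ρ * l) * n + 96 * b + b := by gcongr
        _ ≤ _ := by linarith
    · rw [max_eq_left h.le, one_mul] at hl'
      have h1 : 32 / √(1 + A) ≤ 3072 / (ρ * l) := by
        gcongr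
        norm_num
      calc _ ≤ Φ := norm_sum_prod_exp_le r S
        _ ≤ 32 / √(1 + A) * n + b := hΦ'
        _ ≤ 3072 / (ρ * l) * n + b := by gcongr
        _ ≤ _ := by linarith

end ExponentialSum

/-! ### The multiplier -/

section Multiplier

theorem UnitAddCircle.exists_coe_eq_abs_eq_norm (ξ : UnitAddCircle) :
    ∃ r : ℝ, (r : UnitAddCircle) = ξ ∧ |r| = ‖ξ‖ := by
  obtain ⟨x, rfl⟩ := QuotientAddGroup.mk_surjective ξ
  refine ⟨x - round x, ?_, (UnitAddCircle.norm_eq (x := x)).symm⟩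
  rw [AddCircle.coe_sub, sub_eq_self, AddCircle.coe_eq_zero_iff]
  exact ⟨round x, by simp⟩

theorem norm_ballMultiplier_coe (d N : ℕ) (r : Fin d → ℝ) :
    ‖ballMultiplier d N fun i => (r i : UnitAddCircle)‖ = (#(intBall (Fin d) N) : ℝ)⁻¹ *
      ‖∑ x ∈ intBall (Fin d) N, ∏ i, Complex.exp (2 * Real.pi * Complex.I * x i * r i)‖ := by
  rw [ballMultiplier, latticeBall_toFinset_eq, norm_mul, norm_inv, Complex.norm_natCast]
  congr 2
  refine sum_congr rfl fun x _ => ?_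
  simp only [UnitAddTorus.mFourier, ContinuousMap.coe_mk]
  refine prod_congr rfl fun i _ => ?_
  rw [fourier_coe_apply]
  simp

theorem card_intBall_pos (ι : Type*) [Fintype ι] [DecidableEq ι] (N : ℕ) :
    0 < #(intBall ι N) :=
  card_pos.2 ⟨0, mem_intBall.2 (by simp)⟩

theorem norm_ballMultiplier_le_one (d N : ℕ) (ξ : UnitAddTorus (Fin d)) :
    ‖ballMultiplier d N ξ‖ ≤ 1 := by
  choose r hr _ using fun i => UnitAddCircle.exists_coe_eq_abs_eq_norm (ξ i)
  obtain rfl : (fun i => (r i : UnitAddCircle)) = ξ := funext hr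
  rw [norm_ballMultiplier_coe]
  have h := norm_sum_prod_exp_le (N := N) r ∅
  simp only [cosWeight, prod_empty, sum_const, nsmul_eq_mul, mul_one] at h
  exact inv_mul_le_one_of_le₀ h (by positivity)

theorem ballKappa_sq_mul {d : ℕ} (hd : 1 ≤ d) (t : ℝ) : ballKappa d t ^ 2 * d = t ^ 2 := by
  have hd' : (0 : ℝ) < d := by exact_mod_cast hd
  rw [ballKappa, mul_pow, ← Real.rpow_natCast ((d : ℝ) ^ (-(1 / 2) : ℝ)), ← Real.rpow_mul hd'.le]
  norm_num
  rw [Real.rpow_neg_one]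
  field_simp

/-- For large `κ` the error term is of order `κ⁻¹`. The upper bound on `κ` ensures that the
proportion of `fewLarge`, which is at most `2 ^ (-d)`, is of this order. -/
theorem norm_ballMultiplier_le {d N : ℕ} (hd : 1 ≤ d) (hκ : 2 ^ 22 ≤ ballKappa d N)
    (hκ' : ballKappa d N ≤ 50 * (d : ℝ) ^ (1 / 2 : ℝ)) {ξ : UnitAddTorus (Fin d)} (hξ : ξ ≠ 0) :
    ‖ballMultiplier d N ξ‖ ≤
      2 ^ 40 * ((ballKappa d N * torusNorm ξ)⁻¹ + (ballKappa d N)⁻¹) := by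
  choose r hr hrn using fun i => UnitAddCircle.exists_coe_eq_abs_eq_norm (ξ i)
  obtain rfl : (fun i => (r i : UnitAddCircle)) = ξ := funext hr
  have hnorm : torusNorm (fun i => (r i : UnitAddCircle)) = √(∑ i, r i ^ 2) := by
    rw [torusNorm]
    congr 1
    exact sum_congr rfl fun i _ => by rw [← hrn i, sq_abs]
  have hr2 : ∀ i, |r i| ≤ 1 / 2 := fun i => by
    rw [hrn i]
    simpa using AddCircle.norm_le_half_period (p := (1 : ℝ)) (x := (r i : UnitAddCircle))
      one_ne_zero
  have hr0 : r ≠ 0 := by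
    rintro rfl
    exact hξ (by ext i; simp)
  rw [norm_ballMultiplier_coe, hnorm]
  set κ := ballKappa d N with hκdef
  have hκ0 : 0 < κ := by linarith
  have hκN : κ ^ 2 * Fintype.card (Fin d) = (N : ℝ) ^ 2 := by
    rw [Fintype.card_fin]
    exact ballKappa_sq_mul hd N
  rw [← Real.sqrt_eq_rpow] at hκ'
  have hd1 : (1 : ℝ) ≤ d := by exact_mod_cast hd
  have hsqrt : √(d : ℝ) ≤ d := Real.sqrt_le_iff.2 ⟨by linarith, by nlinarith⟩
  have hd8 : 8 ≤ Fintype.card (Fin d) := by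
    rw [Fintype.card_fin]
    have : (8 : ℝ) ≤ d := by linarith
    exact_mod_cast this
  have hmain := norm_sum_prod_exp_intBall_le (N := N) hr2 hr0 hd8 (ρ := κ / 2 ^ 22) (by positivity)
  have hfew := two_pow_mul_card_fewLarge_le hκ hκN
  set n : ℝ := ((#(intBall (Fin d) N) : ℕ) : ℝ)
  set b : ℝ := ((#(fewLarge (Fin d) N (κ / 2 ^ 22)) : ℕ) : ℝ)
  have hn : 0 < n := Nat.cast_pos.2 (card_intBall_pos (Fin d) N)
  have hb0 : 0 ≤ b := Nat.cast_nonneg _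
  -- The exceptional points are absorbed in the error term by `2 ^ d ≥ d ≥ κ / 50`.
  have hb : b ≤ 50 / κ * n := by
    have h2d : κ / 50 ≤ 2 ^ Fintype.card (Fin d) := by
      have h1 : ((d : ℕ) : ℝ) ≤ 2 ^ d := by exact_mod_cast Nat.lt_two_pow_self.le
      rw [Fintype.card_fin]
      linarith
    have h3 : κ / 50 * b ≤ n := (mul_le_mul_of_nonneg_right h2d hb0).trans hfew
    rw [div_mul_eq_mul_div, le_div_iff₀ hκ0]
    linarith
  set l := √(∑ i, r i ^ 2)
  have hl : 0 ≤ l := Real.sqrt_nonneg _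
  rw [inv_mul_le_iff₀ hn]
  have e1 : 3072 / (κ / 2 ^ 22 * l) = 3072 * 2 ^ 22 * (κ * l)⁻¹ := by
    rw [div_mul_eq_mul_div, div_div_eq_mul_div, div_eq_mul_inv]
  have e2 : 384 / (κ / 2 ^ 22) = 384 * 2 ^ 22 * κ⁻¹ := by
    rw [div_div_eq_mul_div, div_eq_mul_inv]
  rw [div_eq_mul_inv] at hb
  rw [e1, e2] at hmain
  have h1 : 0 ≤ (κ * l)⁻¹ * n := mul_nonneg (inv_nonneg.2 (mul_nonneg hκ0.le hl)) hn.le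
  have h2 : 0 ≤ κ⁻¹ * n := mul_nonneg (inv_nonneg.2 hκ0.le) hn.le
  nlinarith

end Multiplier

theorem mainTheorem4 :
    ∃ C : ℝ, 0 < C ∧ ∀ d N : ℕ, 1 ≤ d → 1 ≤ N →
      10 ≤ ballKappa d N → ballKappa d N ≤ 50 * (d : ℝ) ^ (1 / 2 : ℝ) →
      ∀ ξ : UnitAddTorus (Fin d), ξ ≠ 0 →
        ‖ballMultiplier d N ξ‖ ≤
          C * ((ballKappa d N * torusNorm ξ)⁻¹ + ballKappa d N ^ (-(1 / 7) : ℝ)) := by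
  refine ⟨2 ^ 40, by norm_num, fun d N hd _ hκ hκ' ξ hξ => ?_⟩
  have hpow : (ballKappa d N)⁻¹ ≤ ballKappa d N ^ (-(1 / 7) : ℝ) := by
    rw [← Real.rpow_neg_one]
    exact Real.rpow_le_rpow_of_exponent_le (by linarith) (by norm_num)
  have hinv : 0 ≤ (ballKappa d N * torusNorm ξ)⁻¹ :=
    inv_nonneg.2 (mul_nonneg (by linarith) (Real.sqrt_nonneg _))
  rcases le_or_gt (2 ^ 22) (ballKappa d N) with h | h
  · exact (norm_ballMultiplier_le hd h hκ' hξ).trans (by gcongr)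
  · have h1 : (2 ^ 22 : ℝ)⁻¹ ≤ (ballKappa d N)⁻¹ := by
      gcongr
    refine (norm_ballMultiplier_le_one d N ξ).trans ?_
    set κ' := ballKappa d N ^ (-(1 / 7) : ℝ)
    set y := (ballKappa d N * torusNorm ξ)⁻¹
    have h2 : (2 ^ 22 : ℝ)⁻¹ ≤ κ' := h1.trans hpow
    norm_num only at h2 ⊢
    linarith
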